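/- Let $q>0$, let $a:[0,\infty)\to[0,\infty)$ be right-continuous (for instance continuous) and let $r:[0,\infty)\to[0,q]$. Below $'$ denotes the right-hand derivative, $[\cdot]$ is the greatest integer function and $[t]_h:=[t/h]\,h$. A solution of $$x'(t)=-a(t)\,x(t-r(t)) \qquad (1)$$ from time $s\ge 0$ is a continuous function on $[s-q,\infty)$ that satisfies (1) for all $t\ge s$; its initial value is its restriction to $[s-q,s]$. Assume: (A1) the zero solution of (1) is uniformly asymptotically stable, i.e. for every $\varepsilon>0$ there is $\delta>0$ such that for every $s\ge0$ each solution $x$ from time $s$ with $\sup_{[s-q,s]}|x|<\delta$ satisfies $|x(t)|<\varepsilon$ for $t\ge s$; and there is $b>0$ such that for every $\varepsilon>0$ there is $T>0$ such that for every $s\ge0$ each solution $x$ from time $s$ with $\sup_{[s-q,s]}|x|<b$ satisfies $|x(t)|<\varepsilon$ for $t\ge s+T$; (A2) $\sup_{t\ge0}a(t)<\infty$; (A3) $r$ is uniformly continuous on $[0,\infty)$. Then: 1. Let $\varphi\in C([-q,0],\mathbb R)$, let $x$ be the solution of (1) from time $0$ with $x=\varphi$ on $[-q,0]$ and, for $h\in(0,q]$,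 let $z_h$ be the solution of $$z_h'(t)=-a(t)\,z_h\big(\big[t-[r([t]_h)]_h\big]_h\big),\quad t\ge0,\qquad z_h(nh)=\varphi(nh)\ \text{ for integers } n \text{ with } -q\le nh\le 0,$$ continuous on $[0,\infty)$. Then $|x(t)-z_h([t]_h)|\to0$ as $h\to0^+$, for each $t\ge0$. 2. There is $h_0>0$ such that for every $h\in(0,h_0)$ the zero solution of the difference equation $$z(n+1)=z(n)-\Big(\int_{nh}^{(n+1)h}a(s)\,ds\Big)\,z(n-k_n),\qquad k_n=[r(nh)/h],$$ is uniformly asymptotically stable, i.e. for every $\varepsilon>0$ there is $\delta>0$ such that for every integer $m\ge0$ each solution $z$ for $n\ge m$ with $|z(j)|<\delta$ for all integers $j$ with $m-[q/h]\le j\le m$ satisfies $|z(n)|<\varepsilon$ for $n\ge m$; and there is $b>0$ such that for every $\varepsilon>0$ there is $N\in\mathbb N$ such that for every integer $m\ge0$ each solution $z$ for $n\ge m$ with $|z(j)|<b$ for all integers $j$ with $m-[q/h]\le j\le m$ satisfies $|z(n)|<\varepsilon$ for $n\ge m+N$. -/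

import Mathlib

/-- `x` solves `x'(t) = -a(t) x(t - r(t))` for `t ≥ s`, where `'` is the right-hand derivative:
`x` is continuous on `[s - q, ∞)` and satisfies the equation at every `t ≥ s`.
The initial value of `x` at `s` is its restriction to `[s - q, s]`. -/
structure IsDelaySolution (q : ℝ) (a r : ℝ → ℝ) (s : ℝ) (x : ℝ → ℝ) : Prop where
  continuousOn : ContinuousOn x (Set.Ici (s - q))
  hasDeriv : ∀ t, s ≤ t → HasDerivWithinAt x (-(a t * x (t - r t))) (Set.Ici t) t

/-- The zero solution of `x'(t) = -a(t) x(t - r(t))`, `t ≥ 0`, is uniformly asymptotically stable: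
it is uniformly stable and uniformly attractive, with constants independent of the
initial time `s ≥ 0`. -/
def DelayUAS (q : ℝ) (a r : ℝ → ℝ) : Prop :=
  (∀ ε > 0, ∃ δ > 0, ∀ s, 0 ≤ s → ∀ x, IsDelaySolution q a r s x →
    (∀ t ∈ Set.Icc (s - q) s, |x t| < δ) → ∀ t, s ≤ t → |x t| < ε) ∧
  (∃ b > 0, ∀ ε > 0, ∃ T > 0, ∀ s, 0 ≤ s → ∀ x, IsDelaySolution q a r s x →
    (∀ t ∈ Set.Icc (s - q) s, |x t| < b) → ∀ t, s + T ≤ t → |x t| < ε)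

/-- `[t]_h = [t / h] h`, with `[·]` the greatest integer function. -/
noncomputable def gridFloor (h t : ℝ) : ℝ := (⌊t / h⌋ : ℝ) * h

/-- `z` solves the equation with piecewise constant argument
`z'(t) = -a(t) z([t - [r([t]_h)]_h]_h)`, `t ≥ 0`, with `z(nh) = φ(nh)` at the grid points
`nh ∈ [-q, 0]`; here `'` is the right-hand derivative and `z` is continuous on `[0, ∞)`. -/
structure IsPCASolution (q : ℝ) (a r φ : ℝ → ℝ) (h : ℝ) (z : ℝ → ℝ) : Prop where
  initial : ∀ n : ℤ, -q ≤ n * h → n * h ≤ 0 → z (n * h) = φ (n * h)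
  continuousOn : ContinuousOn z (Set.Ici 0)
  hasDeriv : ∀ t, 0 ≤ t → HasDerivWithinAt z
    (-(a t * z (gridFloor h (t - gridFloor h (r (gridFloor h t)))))) (Set.Ici t) t

/-- `z` solves `z(n+1) = z(n) - (∫_{nh}^{(n+1)h} a) z(n - k_n)`, `k_n = [r(nh)/h]`, for `n ≥ m`. -/
def IsDifferenceSolution (a r : ℝ → ℝ) (h : ℝ) (m : ℤ) (z : ℤ → ℝ) : Prop :=
  ∀ n, m ≤ n →
    z (n + 1) = z n - (∫ s in (n * h : ℝ)..((n + 1) * h : ℝ), a s) * z (n - ⌊r (n * h) / h⌋)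

/-- The zero solution of the difference equation is uniformly asymptotically stable: uniformly
stable and uniformly attractive, with constants independent of the initial time `m ≥ 0`.
The initial data at time `m` are the values at the integers `j` with `m - q/h ≤ j ≤ m`. -/
def DifferenceUAS (q : ℝ) (a r : ℝ → ℝ) (h : ℝ) : Prop :=
  (∀ ε > 0, ∃ δ > 0, ∀ m : ℤ, 0 ≤ m → ∀ z, IsDifferenceSolution a r h m z →
    (∀ j, m - ⌊q / h⌋ ≤ j → j ≤ m → |z j| < δ) → ∀ n, m ≤ n → |z n| < ε) ∧
  (∃ b > 0, ∀ ε > 0, ∃ N : ℕ, ∀ m : ℤ, 0 ≤ m → ∀ z, IsDifferenceSolution a r h m z →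
    (∀ j, m - ⌊q / h⌋ ≤ j → j ≤ m → |z j| < b) → ∀ n, m + N ≤ n → |z n| < ε)

/-! Integrating (1) over one step of length `h` gives the difference equation with `x (u - r u)`,
kept under the integral, in place of `z (n - k)`. A discrete Grönwall argument,
`abs_delaySolution_sub_differenceSolution_le`, bounds the gap after `i` steps by `ω * ((1 + M * h) ^
i - 1)`. Here `ω` is the consistency error: the variation of `x` between the exact and the grid
delayed arguments, which differ by at most `2 * h` plus the oscillation of `r` over a step. On a
compact time interval `x` is uniformly continuous, so `ω` is small with `h`; this gives the first
assertion.

For the second, `ω` must be small uniformly in the initial time. The initial values of `z` are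
arbitrary, but from time `m` on its increments are controlled, so after one more delay window the
data are Lipschitz. They extend to a Lipschitz initial function, from which (1) is solved
(`exists_isDelaySolution`). Uniform stability keeps `x` Lipschitz, uniform attractivity makes it
small after a time `T`, and Grönwall over a time at most `T + 2 * q` passes the smallness to `z`.
Hence the sup of `z` over a delay window halves after `P` steps, with `P` independent of `m` and `z`
(`exists_window_halving`). The halving is relative to the size of the data, so it iterates to
exponential decay. -/

open MeasureTheory

/-! ### Measurability of right-continuous coefficients -/

/-- A function on the line that is right-continuous at every point is Borel measurable. -/
theorem measurable_of_continuousWithinAt_Ici {f : ℝ → ℝ}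
    (hf : ∀ t, ContinuousWithinAt f (Set.Ici t) t) : Measurable f := by
  -- The sample points lie in `(t, t + 1 / (n + 1)]`, so right-continuity gives pointwise
  -- convergence; each approximant factors through `ℤ`.
  have hmeas : ∀ n : ℕ, Measurable fun t : ℝ => f ((⌊((n : ℝ) + 1) * t⌋ + 1) / ((n : ℝ) + 1)) := by
    intro n
    have h1 : Measurable fun k : ℤ => f (((k : ℝ) + 1) / ((n : ℝ) + 1)) :=
      measurable_of_countable _
    exact h1.comp (Int.measurable_floor.comp (measurable_const.mul measurable_id))
  refine measurable_of_tendsto_metrizable hmeas (tendsto_pi_nhds.2 fun t => ?_)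
  have hpos : ∀ n : ℕ, (0 : ℝ) < (n : ℝ) + 1 := fun n => by positivity
  refine (hf t).tendsto.comp (tendsto_nhdsWithin_iff.2 ⟨?_, Filter.Eventually.of_forall fun n => ?_⟩)
  · have hlim : Filter.Tendsto (fun n : ℕ => t + 1 / ((n : ℝ) + 1)) Filter.atTop (nhds t) := by
      simpa using (tendsto_const_nhds (x := t)).add tendsto_one_div_add_atTop_nhds_zero_nat
    refine tendsto_of_tendsto_of_tendsto_of_le_of_le tendsto_const_nhds hlim
      (fun n => ?_) (fun n => ?_)
    · have := Int.lt_floor_add_one (((n : ℝ) + 1) * t)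
      change t ≤ _
      rw [le_div_iff₀ (hpos n)]
      linarith
    · have := Int.floor_le (((n : ℝ) + 1) * t)
      change _ ≤ t + 1 / ((n : ℝ) + 1)
      rw [div_le_iff₀ (hpos n), add_mul t, one_div, inv_mul_cancel₀ (hpos n).ne']
      linarith
  · have := Int.lt_floor_add_one (((n : ℝ) + 1) * t)
    change t ≤ _
    rw [le_div_iff₀ (hpos n)]
    linarith

theorem intervalIntegrable_of_measurable_of_bound {a : ℝ → ℝ} {M : ℝ} (ha : Measurable a)
    (hM : ∀ t, |a t| ≤ M) (c d : ℝ) : IntervalIntegrable a volume c d := by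
  refine (intervalIntegrable_const (c := M)).mono_fun ha.aestronglyMeasurable
    (Filter.Eventually.of_forall fun t => ?_)
  exact (hM t).trans (le_abs_self M)

/-! ### Existence for the delay equation by contraction -/

/-- Weighted bound for the Volterra operator of the delay equation. -/
theorem abs_integral_exp_weight_le {a r y : ℝ → ℝ} {M B s τ : ℝ} (hM0 : 0 < M)
    (hM : ∀ t, |a t| ≤ M) (hr : ∀ t, 0 ≤ r t) (hB : ∀ t, |y t| ≤ B) (hτ : s ≤ τ) :
    |∫ u in s..τ, a u * (Real.exp (2 * M * max (u - r u - s) 0) * y (u - r u))|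
      ≤ B / 2 * Real.exp (2 * M * (τ - s)) := by
  have hB0 : 0 ≤ B := (abs_nonneg _).trans (hB 0)
  have hcont : Continuous fun u => M * B * Real.exp (2 * M * (u - s)) := by fun_prop
  have h1 : ‖∫ u in s..τ, a u * (Real.exp (2 * M * max (u - r u - s) 0) * y (u - r u))‖
      ≤ ∫ u in s..τ, M * B * Real.exp (2 * M * (u - s)) := by
    refine intervalIntegral.norm_integral_le_of_norm_le hτ
      (Filter.Eventually.of_forall fun u hu => ?_) (hcont.intervalIntegrable _ _)
    rw [Real.norm_eq_abs, abs_mul, abs_mul, Real.abs_exp]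
    have h2 : Real.exp (2 * M * max (u - r u - s) 0) ≤ Real.exp (2 * M * (u - s)) := by
      refine Real.exp_le_exp.2 (mul_le_mul_of_nonneg_left (max_le ?_ ?_) (by positivity))
      · linarith [hr u]
      · linarith [hu.1]
    calc |a u| * (Real.exp (2 * M * max (u - r u - s) 0) * |y (u - r u)|)
        ≤ M * (Real.exp (2 * M * (u - s)) * B) := by
          gcongr
          · exact hM u
          · exact hB _
      _ = _ := by ring
  have h3 : ∫ u in s..τ, M * B * Real.exp (2 * M * (u - s))
      = B / 2 * Real.exp (2 * M * (τ - s)) - B / 2 * Real.exp (2 * M * (s - s)) := by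
    refine intervalIntegral.integral_eq_sub_of_hasDerivAt
      (f := fun u => B / 2 * Real.exp (2 * M * (u - s))) (fun u _ => ?_)
      (hcont.intervalIntegrable _ _)
    have h4 : HasDerivAt (fun u : ℝ => 2 * M * (u - s)) (2 * M * 1) u :=
      ((hasDerivAt_id u).sub_const s).const_mul (2 * M)
    refine (h4.exp.const_mul (B / 2)).congr_deriv ?_
    ring
  rw [h3, Real.norm_eq_abs] at h1
  have : 0 ≤ B / 2 * Real.exp (2 * M * (s - s)) := by positivity
  linarith

/-- Solvability of the integrated delay equation with bounded continuous initial function. -/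
theorem exists_integral_delay_eq {a r ψ : ℝ → ℝ} {M C s : ℝ} (ha : Measurable a) (hM0 : 0 < M)
    (hM : ∀ t, |a t| ≤ M) (hr : ∀ t, 0 ≤ r t) (hrc : Continuous r) (hψ : Continuous ψ)
    (hC : ∀ t, |ψ t| ≤ C) :
    ∃ x : ℝ → ℝ, Continuous x ∧
      ∀ t, x t = ψ (min t s) - ∫ u in s..max t s, a u * x (u - r u) := by
  -- The unknown is `y = x / w`. With the rate `2 * M` the integral operator has norm at most `1 /
  -- 2` on bounded continuous functions, so one contraction solves the equation for all times.
  let w : ℝ → ℝ := fun t => Real.exp (2 * M * max (t - s) 0)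
  have hw : Continuous w := by fun_prop
  have hwpos : ∀ t, 0 < w t := fun t => Real.exp_pos _
  have hw1 : ∀ t, 1 ≤ w t := fun t => Real.one_le_exp (by positivity)
  have hwmax : ∀ t, Real.exp (2 * M * (max t s - s)) = w t := fun t => by
    simp only [w]
    rw [← max_sub_sub_right, sub_self]
  have hC0 : 0 ≤ C := (abs_nonneg _).trans (hC 0)
  have hint : ∀ y : ℝ → ℝ, Continuous y → ∀ c d,
      IntervalIntegrable (fun u => a u * (w (u - r u) * y (u - r u))) volume c d := by
    intro y hy c d
    exact (intervalIntegrable_of_measurable_of_bound ha hM c d).mul_continuousOn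
      (by fun_prop : Continuous fun u => w (u - r u) * y (u - r u)).continuousOn
  have hbound : ∀ (y : ℝ → ℝ) (B : ℝ), (∀ t, |y t| ≤ B) → ∀ t,
      |∫ u in s..max t s, a u * (w (u - r u) * y (u - r u))| ≤ B / 2 * w t := by
    intro y B hB t
    have := abs_integral_exp_weight_le (τ := max t s) hM0 hM hr hB (le_max_right t s)
    rwa [hwmax] at this
  let G : ℝ → (ℝ → ℝ) → ℝ := fun t y =>
    (ψ (min t s) - ∫ u in s..max t s, a u * (w (u - r u) * y (u - r u))) / w t
  have hGc : ∀ y : ℝ → ℝ, Continuous y → Continuous fun t => G t y := by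
    intro y hy
    have h1 : Continuous fun t => ∫ u in s..max t s, a u * (w (u - r u) * y (u - r u)) :=
      (intervalIntegral.continuous_primitive (hint y hy) s).comp
        (continuous_id.max continuous_const)
    exact ((hψ.comp (continuous_id.min continuous_const)).sub h1).div hw fun t => (hwpos t).ne'
  have hGb : ∀ (y : ℝ → ℝ) (B : ℝ), (∀ t, |y t| ≤ B) → ∀ t, ‖G t y‖ ≤ C + B / 2 := by
    intro y B hB t
    rw [Real.norm_eq_abs, abs_div, abs_of_pos (hwpos t), div_le_iff₀ (hwpos t)]
    have h1 := abs_sub (ψ (min t s)) (∫ u in s..max t s, a u * (w (u - r u) * y (u - r u)))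
    have h2 := hbound y B hB t
    nlinarith [hC (min t s), hw1 t]
  let F : BoundedContinuousFunction ℝ ℝ → BoundedContinuousFunction ℝ ℝ := fun y =>
    BoundedContinuousFunction.ofNormedAddCommGroup (fun t => G t y) (hGc y y.continuous)
      (C + ‖y‖ / 2) (hGb y ‖y‖ fun t => y.norm_coe_le_norm t)
  have hF : ContractingWith (1 / 2) F := by
    refine ⟨by rw [div_lt_one] <;> norm_num, LipschitzWith.of_dist_le_mul fun y₁ y₂ => ?_⟩
    rw [BoundedContinuousFunction.dist_le (by positivity)]
    intro t
    change dist (G t y₁) (G t y₂) ≤ _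
    have h1 : G t y₁ - G t y₂
        = -(∫ u in s..max t s, a u * (w (u - r u) * (y₁ - y₂) (u - r u))) / w t := by
      have h2 := intervalIntegral.integral_sub (hint y₁ y₁.continuous s (max t s))
        (hint y₂ y₂.continuous s (max t s))
      have h3 : (∫ u in s..max t s, a u * (w (u - r u) * (y₁ - y₂) (u - r u)))
          = ∫ u in s..max t s, (a u * (w (u - r u) * y₁ (u - r u))
            - a u * (w (u - r u) * y₂ (u - r u))) := by
        congr 1
        ext u
        rw [BoundedContinuousFunction.sub_apply]
        ring
      simp only [G]
      rw [h3, h2]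
      ring
    have h4 := hbound (y₁ - y₂ : BoundedContinuousFunction ℝ ℝ) ‖y₁ - y₂‖
      (fun t => (y₁ - y₂).norm_coe_le_norm t) t
    rw [Real.dist_eq, h1, abs_div, abs_neg, abs_of_pos (hwpos t), div_le_iff₀ (hwpos t),
      dist_eq_norm]
    refine h4.trans (le_of_eq ?_)
    push_cast
    ring
  let y := ContractingWith.fixedPoint F hF
  have hy : F y = y := hF.fixedPoint_isFixedPt
  refine ⟨fun t => w t * y t, hw.mul y.continuous, fun t => ?_⟩
  have h5 : G t y = y t := congrArg (fun f : BoundedContinuousFunction ℝ ℝ => f t) hy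
  change w t * y t = _
  rw [← h5]
  have h6 : w t ≠ 0 := (hwpos t).ne'
  exact mul_div_cancel₀ _ h6

/-- Extending a function from the half-line by its value at `0` keeps right-continuity. -/
theorem continuousWithinAt_comp_max_zero {a : ℝ → ℝ}
    (ha_cont : ∀ t, 0 ≤ t → ContinuousWithinAt a (Set.Ici t) t) (t : ℝ) :
    ContinuousWithinAt (fun t => a (max t 0)) (Set.Ici t) t := by
  refine (ha_cont _ (le_max_right t 0)).comp (t := Set.Ici (max t 0))
    (continuous_id.max continuous_const).continuousWithinAt fun u hu => ?_
  exact max_le_max (Set.mem_Ici.1 hu) (le_refl (0 : ℝ))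

/-- Solvability of the initial value problem for the delay equation. -/
theorem exists_isDelaySolution {a r ψ : ℝ → ℝ} {q M C s : ℝ} (hs : 0 ≤ s)
    (ha_cont : ∀ t, 0 ≤ t → ContinuousWithinAt a (Set.Ici t) t)
    (hM : ∀ t, 0 ≤ t → |a t| ≤ M) (hr : ∀ t, 0 ≤ t → 0 ≤ r t)
    (hrc : ContinuousOn r (Set.Ici 0)) (hψ : Continuous ψ) (hC : ∀ t, |ψ t| ≤ C) :
    ∃ x : ℝ → ℝ, IsDelaySolution q a r s x ∧ ∀ t ≤ s, x t = ψ t := by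
  have hmax : ∀ t, max t 0 ∈ Set.Ici (0 : ℝ) := fun t => le_max_right t 0
  have hac := continuousWithinAt_comp_max_zero ha_cont
  have hrc' : Continuous fun t => r (max t 0) :=
    hrc.comp_continuous (continuous_id.max continuous_const) hmax
  have ham := measurable_of_continuousWithinAt_Ici hac
  obtain ⟨x, hxc, hx⟩ := exists_integral_delay_eq (s := s) (M := |M| + 1) ham (by positivity)
    (fun t => (hM _ (hmax t)).trans (by linarith [le_abs_self M])) (fun t => hr _ (hmax t))
    hrc' hψ hC
  refine ⟨x, ⟨hxc.continuousOn, fun t ht => ?_⟩, fun t ht => ?_⟩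
  · have hxd : Continuous fun u => x (u - r (max u 0)) := 
      hxc.comp (continuous_id.sub hrc')
    have hint : ∀ c d, IntervalIntegrable (fun u => a (max u 0) * x (u - r (max u 0)))
        volume c d := fun c d =>
      (intervalIntegrable_of_measurable_of_bound ham (fun t => hM _ (hmax t)) c d).mul_continuousOn
        hxd.continuousOn
    have h1 := intervalIntegral.integral_hasDerivWithinAt_right (s := Set.Ici t) (t := Set.Ioi t)
      (hint s t) (ham.mul hxd.measurable).stronglyMeasurable.stronglyMeasurableAtFilter
      ((((hac t).mono Set.Ioi_subset_Ici_self).mul hxd.continuousWithinAt))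
    have h2 := h1.const_sub (ψ s)
    rw [max_eq_left (hs.trans ht)] at h2
    refine h2.congr (fun u hu => ?_) ?_
    · rw [hx u, max_eq_left (ht.trans hu), min_eq_right (ht.trans hu)]
    · rw [hx t, max_eq_left ht, min_eq_right ht]
  · rw [hx t, max_eq_right ht, min_eq_left ht]
    simp

/-- A bounded right-continuous coefficient is integrable on compact intervals of the half-line. -/
theorem intervalIntegrable_of_rightContinuous {a : ℝ → ℝ} {M c d : ℝ} (hc : 0 ≤ c) (hd : 0 ≤ d)
    (ha_cont : ∀ t, 0 ≤ t → ContinuousWithinAt a (Set.Ici t) t)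
    (hM : ∀ t, 0 ≤ t → |a t| ≤ M) : IntervalIntegrable a volume c d := by
  have hmax : ∀ t, max t 0 ∈ Set.Ici (0 : ℝ) := fun t => le_max_right t 0
  have hac := continuousWithinAt_comp_max_zero ha_cont
  refine (intervalIntegrable_of_measurable_of_bound (measurable_of_continuousWithinAt_Ici hac)
    (fun t => hM _ (hmax t)) c d).congr fun u hu => ?_
  have : 0 ≤ u := (le_min hc hd).trans hu.1.le
  change a (max u 0) = a u
  rw [max_eq_left this]

/-! ### Integrated form and Lipschitz bound for the delay equation -/

theorem IsDelaySolution.continuousOn_delay {q s : ℝ} {a r x : ℝ → ℝ} (hs : 0 ≤ s)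
    (hx : IsDelaySolution q a r s x) (hr : ∀ t, 0 ≤ t → r t ∈ Set.Icc 0 q)
    (hrc : ContinuousOn r (Set.Ici 0)) : ContinuousOn (fun u => x (u - r u)) (Set.Ici s) := by
  refine hx.continuousOn.comp
    (continuousOn_id.sub (hrc.mono (Set.Ici_subset_Ici.2 hs))) fun u hu => ?_
  have hu' : s ≤ u := hu
  have := (hr u (hs.trans hu')).2
  change s - q ≤ u - r u
  linarith

theorem IsDelaySolution.intervalIntegrable {q s c d M : ℝ} {a r x : ℝ → ℝ} (hs : 0 ≤ s)
    (hx : IsDelaySolution q a r s x) (hr : ∀ t, 0 ≤ t → r t ∈ Set.Icc 0 q)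
    (hrc : ContinuousOn r (Set.Ici 0))
    (ha_cont : ∀ t, 0 ≤ t → ContinuousWithinAt a (Set.Ici t) t)
    (hM : ∀ t, 0 ≤ t → |a t| ≤ M) (hc : s ≤ c) (hd : s ≤ d) :
    IntervalIntegrable (fun u => a u * x (u - r u)) volume c d :=
  (intervalIntegrable_of_rightContinuous (hs.trans hc) (hs.trans hd) ha_cont hM).mul_continuousOn
    ((hx.continuousOn_delay hs hr hrc).mono fun _ hu => (le_min hc hd).trans hu.1)

/-- Integrated form of the delay equation. -/
theorem IsDelaySolution.integral_eq {q s c d M : ℝ} {a r x : ℝ → ℝ} (hs : 0 ≤ s) (hq : 0 ≤ q)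
    (hx : IsDelaySolution q a r s x) (hr : ∀ t, 0 ≤ t → r t ∈ Set.Icc 0 q)
    (hrc : ContinuousOn r (Set.Ici 0))
    (ha_cont : ∀ t, 0 ≤ t → ContinuousWithinAt a (Set.Ici t) t)
    (hM : ∀ t, 0 ≤ t → |a t| ≤ M) (hc : s ≤ c) (hd : s ≤ d) :
    ∫ u in c..d, a u * x (u - r u) = x c - x d := by
  have h1 := intervalIntegral.integral_eq_sub_of_hasDeriv_right (a := c) (b := d)
    (hx.continuousOn.mono fun u hu => ?_)
    (fun u hu => (hx.hasDeriv u ((le_min hc hd).trans hu.1.le)).mono Set.Ioi_subset_Ici_self)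
    (hx.intervalIntegrable hs hr hrc ha_cont hM hc hd).neg
  · rw [intervalIntegral.integral_neg] at h1
    linarith
  · have : s ≤ u := (le_min hc hd).trans hu.1
    change s - q ≤ u
    linarith

/-- A bounded solution of the delay equation is Lipschitz after the initial time. -/
theorem IsDelaySolution.abs_sub_le {q s c d M B : ℝ} {a r x : ℝ → ℝ} (hs : 0 ≤ s) (hq : 0 ≤ q)
    (hx : IsDelaySolution q a r s x) (hr : ∀ t, 0 ≤ t → r t ∈ Set.Icc 0 q)
    (hrc : ContinuousOn r (Set.Ici 0))
    (ha_cont : ∀ t, 0 ≤ t → ContinuousWithinAt a (Set.Ici t) t)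
    (hM : ∀ t, 0 ≤ t → |a t| ≤ M) (hB : ∀ t, s - q ≤ t → |x t| ≤ B) (hc : s ≤ c) (hd : s ≤ d) :
    |x c - x d| ≤ M * B * |c - d| := by
  rw [← hx.integral_eq hs hq hr hrc ha_cont hM hc hd, abs_sub_comm c d, ← Real.norm_eq_abs]
  refine intervalIntegral.norm_integral_le_of_norm_le_const fun u hu => ?_
  have hu' : s ≤ u := (le_min hc hd).trans hu.1.le
  have h1 := (hr u (hs.trans hu')).2
  have h2 := hM u (hs.trans hu')
  rw [Real.norm_eq_abs, abs_mul]
  exact mul_le_mul h2 (hB _ (by linarith)) (abs_nonneg _) ((abs_nonneg _).trans h2)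

/-! ### Grid arithmetic and the discrete Grönwall comparison -/

theorem floor_div_mem {q h ρ : ℝ} (hh : 0 < h) (hρ : ρ ∈ Set.Icc 0 q) :
    0 ≤ ⌊ρ / h⌋ ∧ ⌊ρ / h⌋ ≤ ⌊q / h⌋ :=
  ⟨Int.floor_nonneg.2 (div_nonneg hρ.1 hh.le),
    Int.floor_le_floor (div_le_div_of_nonneg_right hρ.2 hh.le)⟩

theorem floor_div_mul_le {h t : ℝ} (hh : 0 < h) : (⌊t / h⌋ : ℝ) * h ≤ t :=
  (le_div_iff₀ hh).1 (Int.floor_le _)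

theorem lt_floor_div_add_one_mul {h t : ℝ} (hh : 0 < h) : t < ((⌊t / h⌋ : ℝ) + 1) * h :=
  (div_lt_iff₀ hh).1 (Int.lt_floor_add_one _)

/-- The exact and the discretized delayed arguments are close. -/
theorem abs_delayed_argument_sub_le {h u ρ : ℝ} {r : ℝ → ℝ} {n : ℤ} (hh : 0 < h)
    (hu : u ∈ Set.Icc (n * h : ℝ) ((n + 1) * h)) (hρ : |r u - r (n * h)| ≤ ρ) :
    |(u - r u) - ((n - ⌊r (n * h) / h⌋ : ℤ) : ℝ) * h| ≤ 2 * h + ρ := by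
  have h1 := floor_div_mul_le (t := r (n * h)) hh
  have h2 := lt_floor_div_add_one_mul (t := r (n * h)) hh
  have h3 := abs_le.1 hρ
  push_cast
  rw [abs_le]
  constructor <;> nlinarith [hu.1, hu.2]

/-- Discrete Grönwall comparison of a solution of the delay equation with a solution of the
difference equation that has the same initial data. -/
theorem abs_delaySolution_sub_differenceSolution_le {q h M ω : ℝ} {a r x : ℝ → ℝ} {z : ℤ → ℝ}
    {m : ℤ} {N : ℕ} (hq : 0 ≤ q) (hh : 0 < h) (hm : 0 ≤ m)
    (hr : ∀ t, 0 ≤ t → r t ∈ Set.Icc 0 q) (hrc : ContinuousOn r (Set.Ici 0))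
    (ha_cont : ∀ t, 0 ≤ t → ContinuousWithinAt a (Set.Ici t) t)
    (hM : ∀ t, 0 ≤ t → |a t| ≤ M)
    (hx : IsDelaySolution q a r (m * h) x) (hz : IsDifferenceSolution a r h m z)
    (hini : ∀ j, m - ⌊q / h⌋ ≤ j → j ≤ m → x (j * h) = z j)
    (hω : ∀ n, m ≤ n → n < m + N → ∀ u ∈ Set.Icc (n * h : ℝ) ((n + 1) * h),
      |x (u - r u) - x (((n - ⌊r (n * h) / h⌋ : ℤ) : ℝ) * h)| ≤ ω) :
    ∀ i : ℕ, i ≤ N → ∀ j, m - ⌊q / h⌋ ≤ j → j ≤ m + i →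
      |x (j * h) - z j| ≤ ω * ((1 + M * h) ^ i - 1) := by
  have hM0 : 0 ≤ M := (abs_nonneg _).trans (hM 0 le_rfl)
  have hm' : (0 : ℝ) ≤ m := by exact_mod_cast hm
  intro i
  induction i with
  | zero =>
    intro _ j hj1 hj2
    rw [hini j hj1 (by simpa using hj2)]
    simp
  | succ i ih =>
    intro hi j hj1 hj2
    have ih := ih (by omega)
    set E := ω * ((1 + M * h) ^ i - 1) with hE
    have hω0 : 0 ≤ ω := (abs_nonneg _).trans
      (hω (m + i) (by omega) (by omega) (((m + i : ℤ) : ℝ) * h)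
        ⟨le_rfl, by nlinarith⟩)
    -- The claimed bound solves this error recursion exactly.
    have hstep : ω * ((1 + M * h) ^ (i + 1) - 1) = E + M * h * (ω + E) := by
      rw [hE]
      ring
    have hE0 : 0 ≤ E := mul_nonneg hω0
      (sub_nonneg.2 (one_le_pow₀ (by nlinarith [mul_nonneg hM0 hh.le])))
    rw [hstep]
    by_cases hj : j ≤ m + i
    · have := ih j hj1 hj
      nlinarith [mul_nonneg (mul_nonneg hM0 hh.le) (add_nonneg hω0 hE0)]
    obtain ⟨n, rfl⟩ : ∃ n, j = n + 1 := ⟨j - 1, by ring⟩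
    have hn : n = m + i := by push_cast at hj2; omega
    have hmn : m ≤ n := by omega
    have hn0 : (m : ℝ) * h ≤ n * h := by
      have : (m : ℝ) ≤ n := by exact_mod_cast hmn
      gcongr
    have hn1 : (n : ℝ) * h ≤ (n + 1) * h := by nlinarith
    have hs : (0 : ℝ) ≤ m * h := by positivity
    set k := ⌊r (n * h) / h⌋ with hk
    have hkq := floor_div_mem hh (hr (n * h) (hs.trans hn0))
    have hdel := ih (n - k) (by omega) (by omega)
    have hint := hx.intervalIntegrable hs hr hrc ha_cont hM hn0 (hn0.trans hn1)
    have haint := intervalIntegrable_of_rightContinuous (hs.trans hn0)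
      (hs.trans (hn0.trans hn1)) ha_cont hM
    have heq : x (((n + 1 : ℤ) : ℝ) * h) - z (n + 1) = (x (n * h) - z n)
        - ∫ u in (n * h : ℝ)..((n + 1) * h), a u * (x (u - r u) - z (n - k)) := by
      have h1 : ∫ u in (n * h : ℝ)..((n + 1) * h), a u * (x (u - r u) - z (n - k))
          = (∫ u in (n * h : ℝ)..((n + 1) * h), a u * x (u - r u))
            - (∫ u in (n * h : ℝ)..((n + 1) * h), a u) * z (n - k) := by
        rw [← intervalIntegral.integral_mul_const,
          ← intervalIntegral.integral_sub hint (haint.mul_const _)]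
        congr 1
        ext u
        ring
      rw [h1, hx.integral_eq hs hq hr hrc ha_cont hM hn0 (hn0.trans hn1), hz n hmn]
      push_cast
      ring
    have hbd : |∫ u in (n * h : ℝ)..((n + 1) * h), a u * (x (u - r u) - z (n - k))|
        ≤ M * (ω + E) * |(n + 1) * h - n * h| := by
      rw [← Real.norm_eq_abs]
      refine intervalIntegral.norm_integral_le_of_norm_le_const fun u hu => ?_
      rw [Set.uIoc_of_le hn1] at hu
      have h1 := hω n hmn (by omega) u ⟨hu.1.le, hu.2⟩
      have h2 := hM u (hs.trans (hn0.trans hu.1.le))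
      rw [Real.norm_eq_abs, abs_mul]
      refine mul_le_mul h2 ?_ (abs_nonneg _) hM0
      -- Consistency error `ω` plus the error `E` propagated from the earlier grid point.
      exact (abs_sub_le _ (x (((n - k : ℤ) : ℝ) * h)) _).trans (add_le_add h1 hdel)
    have hlen : |((n : ℝ) + 1) * h - n * h| = h := by
      rw [show ((n : ℝ) + 1) * h - n * h = h by ring, abs_of_pos hh]
    rw [hlen] at hbd
    rw [heq]
    refine (abs_sub _ _).trans ?_
    have := ih n (by omega) (by omega)
    linarith

theorem one_add_pow_le_exp {y : ℝ} (hy : 0 ≤ y) (n : ℕ) : (1 + y) ^ n ≤ Real.exp (n * y) := by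
  rw [Real.exp_nat_mul]
  exact pow_le_pow_left₀ (by linarith) (by linarith [Real.add_one_le_exp y]) n

/-! ### Convergence on compact time intervals -/

/-- Grid values of a solution of the equation with piecewise constant argument solve the
difference equation. -/
theorem IsPCASolution.isDifferenceSolution {q h M : ℝ} {a r φ z : ℝ → ℝ} (hh : 0 < h)
    (ha_cont : ∀ t, 0 ≤ t → ContinuousWithinAt a (Set.Ici t) t)
    (hM : ∀ t, 0 ≤ t → |a t| ≤ M) (hz : IsPCASolution q a r φ h z) :
    IsDifferenceSolution a r h 0 fun n => z (n * h) := by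
  intro n hn
  have hn' : (0 : ℝ) ≤ n := by exact_mod_cast hn
  have hn0 : (0 : ℝ) ≤ n * h := by positivity
  have hn1 : (n : ℝ) * h ≤ (n + 1) * h := by nlinarith
  have hgrid : ∀ (j : ℤ) (t : ℝ), t ∈ Set.Ico (j * h : ℝ) ((j + 1) * h) →
      gridFloor h t = j * h := by
    intro j t ht
    have : ⌊t / h⌋ = j := by
      rw [Int.floor_eq_iff, le_div_iff₀ hh, div_lt_iff₀ hh]
      exact ht
    rw [gridFloor, this]
  have h1 := intervalIntegral.integral_eq_sub_of_hasDeriv_right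
    (f := z) (f' := fun u => -(a u * z (((n - ⌊r (n * h) / h⌋ : ℤ) : ℝ) * h)))
    (a := n * h) (b := (n + 1) * h)
    (hz.continuousOn.mono fun u hu => ?_) (fun u hu => ?_) ?_
  · rw [intervalIntegral.integral_neg, intervalIntegral.integral_mul_const] at h1
    push_cast at h1 ⊢
    linarith
  · rw [Set.uIcc_of_le hn1] at hu
    exact hn0.trans hu.1
  · rw [min_eq_left hn1, max_eq_right hn1] at hu
    have h2 := (hz.hasDeriv u (hn0.trans hu.1.le)).mono Set.Ioi_subset_Ici_self
    rw [hgrid n u ⟨hu.1.le, hu.2⟩] at h2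
    rwa [hgrid (n - ⌊r (n * h) / h⌋) (u - gridFloor h (r (n * h)))] at h2
    simp only [gridFloor, Set.mem_Ico]
    push_cast
    constructor <;> nlinarith [hu.1, hu.2]
  · exact ((intervalIntegrable_of_rightContinuous hn0 (hn0.trans hn1) ha_cont hM).mul_const _).neg

/-- Convergence of the discretization on compact time intervals. -/
theorem tendsto_delaySolution_sub_pcaSolution {q M : ℝ} (hq : 0 < q) {a r φ x : ℝ → ℝ}
    {z : ℝ → ℝ → ℝ}
    (ha_cont : ∀ t, 0 ≤ t → ContinuousWithinAt a (Set.Ici t) t)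
    (hr : ∀ t, 0 ≤ t → r t ∈ Set.Icc 0 q) (hM : ∀ t, 0 ≤ t → |a t| ≤ M)
    (hA3 : UniformContinuousOn r (Set.Ici 0))
    (hx : IsDelaySolution q a r 0 x) (hxφ : ∀ t ∈ Set.Icc (-q) 0, x t = φ t)
    (hz : ∀ h ∈ Set.Ioc 0 q, IsPCASolution q a r φ h (z h)) {t : ℝ} (ht : 0 ≤ t) :
    Filter.Tendsto (fun h => |x t - z h (gridFloor h t)|)
      (nhdsWithin 0 (Set.Ioi 0)) (nhds 0) := by
  have hM0 : 0 ≤ M := (abs_nonneg _).trans (hM 0 le_rfl)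
  have hxc : ContinuousOn x (Set.Icc (-q) t) := hx.continuousOn.mono fun u hu => by
    rw [zero_sub]
    exact hu.1
  have hxu := isCompact_Icc.uniformContinuousOn_of_continuous hxc
  rw [Metric.uniformContinuousOn_iff] at hxu hA3
  rw [Metric.tendsto_nhds]
  intro ε hε
  -- The gap from `t` to its grid point and the Grönwall error add up to at most `η * (1 + M * h) ^
  -- N ≤ η * Real.exp (M * t) = ε / 2`.
  set η := ε / (2 * Real.exp (M * t)) with hη
  have hη0 : 0 < η := by positivity
  obtain ⟨δ, hδ, hxδ⟩ := hxu η hη0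
  obtain ⟨δ', hδ', hrδ⟩ := hA3 (δ / 2) (by positivity)
  -- With `h < δ / 4` the delayed arguments differ by at most `2 * h + δ / 2 < δ`.
  have hev : ∀ᶠ h in nhdsWithin (0 : ℝ) (Set.Ioi 0), h ∈ Set.Ioo 0 (min (δ / 4) (min δ' q)) :=
    Ioo_mem_nhdsGT (by positivity)
  filter_upwards [hev] with h hh
  obtain ⟨hh0, hh1⟩ := hh
  simp only [lt_min_iff] at hh1
  obtain ⟨hhδ, hhδ', hhq⟩ := hh1
  have hpca := hz h ⟨hh0, hhq.le⟩
  have hN0 : 0 ≤ ⌊t / h⌋ := Int.floor_nonneg.2 (by positivity)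
  obtain ⟨N, hN⟩ := Int.eq_ofNat_of_zero_le hN0
  have hNt := floor_div_mul_le (t := t) hh0
  have hNt' := lt_floor_div_add_one_mul (t := t) hh0
  have hNr : (⌊t / h⌋ : ℝ) = N := by rw [hN]; simp
  have hcmp := abs_delaySolution_sub_differenceSolution_le (z := fun n : ℤ => z h (n * h))
    (m := 0) (N := N) (ω := η) hq.le hh0 le_rfl
    hr (Metric.uniformContinuousOn_iff.2 hA3).continuousOn ha_cont hM (by simpa using hx)
    (hpca.isDifferenceSolution hh0 ha_cont hM) ?_ ?_ N le_rfl N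
    (by have := (floor_div_mem hh0 (Set.right_mem_Icc.2 hq.le)).1; omega) (by omega)
  · have h1 : |x t - x (N * h)| < η := by
      rw [hNr] at hNt hNt'
      refine hxδ t ⟨by linarith, le_rfl⟩ _ ⟨?_, hNt⟩ ?_
      · have : (0 : ℝ) ≤ N * h := by positivity
        linarith
      · rw [Real.dist_eq, abs_lt]
        constructor <;> linarith
    have h2 : (1 + M * h) ^ N ≤ Real.exp (M * t) := by
      refine (one_add_pow_le_exp (by positivity) N).trans (Real.exp_le_exp.2 ?_)
      rw [hNr] at hNt
      nlinarith
    have h3 : η * Real.exp (M * t) = ε / 2 := by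
      rw [hη]
      field_simp
    rw [Real.dist_eq, sub_zero, abs_abs, gridFloor, hNr]
    simp only [Int.cast_natCast] at hcmp
    have h4 := abs_sub_le (x t) (x (N * h)) (z h (N * h))
    nlinarith [mul_le_mul_of_nonneg_left h2 hη0.le]
  · intro j hj1 hj2
    have hj3 : (j : ℝ) * h ≤ 0 := by
      have : (j : ℝ) ≤ 0 := by exact_mod_cast hj2
      nlinarith
    have hj4 : -q ≤ (j : ℝ) * h := by
      have h5 : -(⌊q / h⌋ : ℝ) ≤ j := by
        have : -⌊q / h⌋ ≤ j := by omega
        exact_mod_cast this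
      have := floor_div_mul_le (t := q) hh0
      nlinarith
    rw [hxφ _ ⟨hj4, hj3⟩]
    exact (hpca.initial j hj4 hj3).symm
  · intro n hn0 hnN u hu
    have hn0' : (0 : ℝ) ≤ n := by exact_mod_cast hn0
    have hnh : (0 : ℝ) ≤ n * h := by positivity
    have hu0 : 0 ≤ u := hnh.trans hu.1
    have hut : u ≤ t := by
      have h5 : (n : ℝ) + 1 ≤ ⌊t / h⌋ := by
        have : n + 1 ≤ ⌊t / h⌋ := by omega
        exact_mod_cast this
      nlinarith [hu.2]
    have hru := hr u hu0
    have hrn := hr _ hnh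
    have h6 : |r u - r (n * h)| ≤ δ / 2 := by
      refine (hrδ u hu0 _ hnh ?_).le
      rw [Real.dist_eq, abs_lt]
      constructor <;> nlinarith [hu.1, hu.2]
    have h7 := abs_delayed_argument_sub_le hh0 hu h6
    refine (hxδ _ ⟨by linarith [hru.2], by linarith [hru.1]⟩ _ ⟨?_, ?_⟩
      (lt_of_le_of_lt h7 (by linarith))).le
    · have := floor_div_mul_le (t := r (n * h)) hh0
      push_cast
      nlinarith [hrn.2]
    · have h8 : (0 : ℝ) ≤ ⌊r (n * h) / h⌋ := by exact_mod_cast (floor_div_mem hh0 hrn).1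
      push_cast
      nlinarith [hu.1]

/-! ### A priori bounds for the difference equation and extension of grid data -/

theorem IsDifferenceSolution.mono {a r : ℝ → ℝ} {h : ℝ} {m m' : ℤ} {z : ℤ → ℝ}
    (hz : IsDifferenceSolution a r h m z) (hm : m ≤ m') : IsDifferenceSolution a r h m' z :=
  fun n hn => hz n (hm.trans hn)

/-- One-step increment bound for the difference equation. -/
theorem IsDifferenceSolution.abs_succ_sub_le {a r : ℝ → ℝ} {h M A : ℝ} {m n : ℤ} {z : ℤ → ℝ}
    (hz : IsDifferenceSolution a r h m z) (hh : 0 < h) (hm : 0 ≤ m)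
    (hM : ∀ t, 0 ≤ t → |a t| ≤ M) (hn : m ≤ n) (hA : |z (n - ⌊r (n * h) / h⌋)| ≤ A) :
    |z (n + 1) - z n| ≤ M * h * A := by
  have hn' : (0 : ℝ) ≤ n := by exact_mod_cast hm.trans hn
  have hn1 : (n : ℝ) * h ≤ (n + 1) * h := by nlinarith
  have hM0 : 0 ≤ M := (abs_nonneg _).trans (hM 0 le_rfl)
  have h1 : |∫ s in (n * h : ℝ)..((n + 1) * h), a s| ≤ M * h := by
    have h2 := intervalIntegral.norm_integral_le_of_norm_le_const
      (a := (n * h : ℝ)) (b := (n + 1) * h) (f := a) (C := M) fun u hu => by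
        rw [Set.uIoc_of_le hn1] at hu
        exact hM u ((by positivity : (0 : ℝ) ≤ n * h).trans hu.1.le)
    rwa [show ((n : ℝ) + 1) * h - n * h = h by ring, abs_of_pos hh] at h2
  rw [hz n hn, sub_sub_cancel_left, abs_neg, abs_mul]
  exact mul_le_mul h1 hA (abs_nonneg _) (by positivity)

/-- Exponential growth bound for the difference equation. -/
theorem IsDifferenceSolution.abs_le_growth {q h M A : ℝ} {a r : ℝ → ℝ} {m : ℤ} {z : ℤ → ℝ}
    (hz : IsDifferenceSolution a r h m z) (hh : 0 < h) (hm : 0 ≤ m)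
    (hr : ∀ t, 0 ≤ t → r t ∈ Set.Icc 0 q) (hM : ∀ t, 0 ≤ t → |a t| ≤ M) (hA0 : 0 ≤ A)
    (hA : ∀ j, m - ⌊q / h⌋ ≤ j → j ≤ m → |z j| ≤ A) :
    ∀ (i : ℕ) (j : ℤ), m - ⌊q / h⌋ ≤ j → j ≤ m + i → |z j| ≤ A * (1 + M * h) ^ i := by
  have hM0 : 0 ≤ M := (abs_nonneg _).trans (hM 0 le_rfl)
  intro i
  induction i with
  | zero => simpa using hA
  | succ i ih =>
    intro j hj1 hj2
    have hE0 : 0 ≤ M * h * (A * (1 + M * h) ^ i) := by positivity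
    have hstep : A * (1 + M * h) ^ (i + 1)
        = A * (1 + M * h) ^ i + M * h * (A * (1 + M * h) ^ i) := by ring
    rw [hstep]
    by_cases hj : j ≤ m + i
    · linarith [ih j hj1 hj]
    obtain ⟨n, rfl⟩ : ∃ n, j = n + 1 := ⟨j - 1, by ring⟩
    have hn : n = m + i := by push_cast at hj2; omega
    have hn' : (0 : ℝ) ≤ n := by exact_mod_cast (by omega : 0 ≤ n)
    have hk := floor_div_mem hh (hr (n * h) (by positivity))
    have h1 := hz.abs_succ_sub_le hh hm hM (by omega : m ≤ n)
      (ih (n - ⌊r (n * h) / h⌋) (by omega) (by omega))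
    have h2 := ih n (by omega) (by omega)
    have h3 := abs_sub_abs_le_abs_sub (z (n + 1)) (z n)
    linarith

/-- A bounded solution of the difference equation is Lipschitz on the grid. -/
theorem IsDifferenceSolution.abs_sub_le {q h M C : ℝ} {a r : ℝ → ℝ} {m l : ℤ} {z : ℤ → ℝ}
    (hz : IsDifferenceSolution a r h m z) (hh : 0 < h) (hm : 0 ≤ m)
    (hr : ∀ t, 0 ≤ t → r t ∈ Set.Icc 0 q) (hM : ∀ t, 0 ≤ t → |a t| ≤ M)
    (hC : ∀ j, m - ⌊q / h⌋ ≤ j → j ≤ l → |z j| ≤ C) {i j : ℤ}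
    (hi : m ≤ i) (hil : i ≤ l) (hj : m ≤ j) (hjl : j ≤ l) :
    |z i - z j| ≤ M * C * |(i : ℝ) * h - j * h| := by
  have key : ∀ (d : ℕ) (i : ℤ), m ≤ i → i + d ≤ l → |z (i + d) - z i| ≤ M * C * (d * h) := by
    intro d
    induction d with
    | zero => simp
    | succ d ih =>
      intro i hi hd
      push_cast at hd
      have hn' : (0 : ℝ) ≤ (i + d : ℤ) := by exact_mod_cast (by omega : 0 ≤ i + d)
      have hk := floor_div_mem hh (hr (((i + d : ℤ) : ℝ) * h) (by positivity))
      have h1 := hz.abs_succ_sub_le hh hm hM (by omega : m ≤ i + d)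
        (hC (i + d - ⌊r (((i + d : ℤ) : ℝ) * h) / h⌋) (by omega) (by omega))
      have h2 := ih i hi (by omega)
      have h3 := _root_.abs_sub_le (z (i + d + 1)) (z (i + d)) (z i)
      push_cast
      rw [← add_assoc]
      linarith
  rcases le_total i j with hij | hij
  · obtain ⟨d, rfl⟩ := Int.le.dest hij
    have h1 := key d i hi hjl
    rw [abs_sub_comm, abs_sub_comm ((i : ℝ) * h)]
    push_cast
    rwa [show ((i : ℝ) + d) * h - i * h = d * h by ring, abs_of_nonneg (by positivity : (0 : ℝ) ≤ d * h)]
  · obtain ⟨d, rfl⟩ := Int.le.dest hij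
    have h1 := key d j hj hil
    push_cast
    rwa [show ((j : ℝ) + d) * h - j * h = d * h by ring, abs_of_nonneg (by positivity : (0 : ℝ) ≤ d * h)]

/-- Bounded Lipschitz grid data extend to a bounded Lipschitz function on the line. -/
theorem exists_lipschitz_extension_of_grid {h C Λ : ℝ} {l₁ l₂ : ℤ} {z : ℤ → ℝ} (hh : 0 < h)
    (hC0 : 0 ≤ C) (hΛ : 0 ≤ Λ) (hC : ∀ j, l₁ ≤ j → j ≤ l₂ → |z j| ≤ C)
    (hL : ∀ i j, l₁ ≤ i → i ≤ l₂ → l₁ ≤ j → j ≤ l₂ → |z i - z j| ≤ Λ * |(i : ℝ) * h - j * h|) :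
    ∃ ψ : ℝ → ℝ, (∀ u v, |ψ u - ψ v| ≤ Λ * |u - v|) ∧ Continuous ψ ∧ (∀ u, |ψ u| ≤ C) ∧
      ∀ j : ℤ, l₁ ≤ j → j ≤ l₂ → ψ (j * h) = z j := by
  have hfl : ∀ j : ℤ, ⌊(j : ℝ) * h / h⌋ = j := fun j => by
    rw [mul_div_cancel_right₀ _ hh.ne', Int.floor_intCast]
  have hlip : LipschitzOnWith Λ.toNNReal (fun t => z ⌊t / h⌋)
      {t | ∃ j : ℤ, l₁ ≤ j ∧ j ≤ l₂ ∧ t = j * h} := by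
    refine LipschitzOnWith.of_dist_le_mul ?_
    rintro _ ⟨i, hi1, hi2, rfl⟩ _ ⟨j, hj1, hj2, rfl⟩
    simp only [hfl]
    rw [Real.coe_toNNReal _ hΛ]
    exact hL i j hi1 hi2 hj1 hj2
  obtain ⟨g, hg, hgz⟩ := hlip.extend_real
  -- Truncation to `[-C, C]` keeps the Lipschitz constant and does not change the grid values.
  have hψ : LipschitzWith Λ.toNNReal fun t => max (-C) (min C (g t)) :=
    (hg.const_min C).const_max (-C)
  refine ⟨_, fun u v => ?_, hψ.continuous, fun u => ?_, fun j hj1 hj2 => ?_⟩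
  · have := hψ.dist_le_mul u v
    rwa [Real.coe_toNNReal _ hΛ] at this
  · exact abs_le.2 ⟨le_max_left _ _, max_le (by linarith) (min_le_left _ _)⟩
  · have h1 : z j = g (j * h) := by
      have := hgz ⟨j, hj1, hj2, rfl⟩
      simpa only [hfl] using this
    have h2 := abs_le.1 (hC j hj1 hj2)
    rw [← h1, min_eq_right h2.2, max_eq_right h2.1]

/-! ### Stability relative to the size of the data -/

/-- Rescaling data below the thresholds of `DelayUAS` turns its two clauses into bounds proportional
to the data. -/
theorem IsDelaySolution.const_mul {q s : ℝ} {a r x : ℝ → ℝ} (hx : IsDelaySolution q a r s x)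
    (c : ℝ) : IsDelaySolution q a r s fun t => c * x t where
  continuousOn := continuousOn_const.mul hx.continuousOn
  hasDeriv t ht := ((hx.hasDeriv t ht).const_mul c).congr_deriv (by ring)

/-- Uniform stability of the linear equation as a bound proportional to the initial data. -/
theorem DelayUAS.exists_bound {q : ℝ} {a r : ℝ → ℝ} (hA1 : DelayUAS q a r) :
    ∃ K ≥ 1, ∀ s, 0 ≤ s → ∀ x, IsDelaySolution q a r s x → ∀ B > 0,
      (∀ t ∈ Set.Icc (s - q) s, |x t| ≤ B) → ∀ t, s ≤ t → |x t| ≤ K * B := by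
  obtain ⟨δ, hδ, h⟩ := hA1.1 1 one_pos
  refine ⟨max 1 (2 / δ), le_max_left _ _, fun s hs x hx B hB hxB t ht => ?_⟩
  have h1 := h s hs _ (hx.const_mul (δ / (2 * B))) (fun u hu => ?_) t ht
  · rw [abs_mul, abs_of_pos (by positivity : 0 < δ / (2 * B)), div_mul_eq_mul_div,
      div_lt_one (by positivity)] at h1
    have h2 : |x t| ≤ 2 / δ * B := by
      rw [div_mul_eq_mul_div, le_div_iff₀ hδ]
      linarith
    exact h2.trans (mul_le_mul_of_nonneg_right (le_max_right _ _) hB.le)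
  · rw [abs_mul, abs_of_pos (by positivity : 0 < δ / (2 * B))]
    calc δ / (2 * B) * |x u| ≤ δ / (2 * B) * B := by gcongr; exact hxB u hu
      _ = δ / 2 := by field_simp
      _ < δ := by linarith

/-- Uniform attractivity of the linear equation, relative to the size of the initial data. -/
theorem DelayUAS.exists_decay_time {q κ : ℝ} {a r : ℝ → ℝ} (hA1 : DelayUAS q a r) (hκ : 0 < κ) :
    ∃ T > 0, ∀ s, 0 ≤ s → ∀ x, IsDelaySolution q a r s x → ∀ B > 0,
      (∀ t ∈ Set.Icc (s - q) s, |x t| ≤ B) → ∀ t, s + T ≤ t → |x t| ≤ κ * B := by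
  obtain ⟨b, hb, h⟩ := hA1.2
  obtain ⟨T, hT, h⟩ := h (κ * b / 2) (by positivity)
  refine ⟨T, hT, fun s hs x hx B hB hxB t ht => ?_⟩
  have h1 := h s hs _ (hx.const_mul (b / (2 * B))) (fun u hu => ?_) t ht
  · rw [abs_mul, abs_of_pos (by positivity : 0 < b / (2 * B)), div_mul_eq_mul_div,
      div_lt_iff₀ (by positivity)] at h1
    have h2 : b * |x t| ≤ b * (κ * B) := by linarith
    exact le_of_mul_le_mul_left h2 hb
  · rw [abs_mul, abs_of_pos (by positivity : 0 < b / (2 * B))]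
    calc b / (2 * B) * |x u| ≤ b / (2 * B) * B := by gcongr; exact hxB u hu
      _ = b / 2 := by field_simp
      _ < b := by linarith

/-! ### Halving over a delay window -/

/-- Gluing of Lipschitz bounds on the two sides of a point. -/
theorem abs_sub_le_of_lipschitz_both_sides {f : ℝ → ℝ} {Λ p s : ℝ} (hps : p ≤ s)
    (h₁ : ∀ u v, p ≤ u → u ≤ s → p ≤ v → v ≤ s → |f u - f v| ≤ Λ * |u - v|)
    (h₂ : ∀ u v, s ≤ u → s ≤ v → |f u - f v| ≤ Λ * |u - v|) :
    ∀ u v, p ≤ u → p ≤ v → |f u - f v| ≤ Λ * |u - v| := by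
  have key : ∀ u v, p ≤ u → u ≤ s → s ≤ v → |f u - f v| ≤ Λ * |u - v| := by
    intro u v hu hus hv
    have h3 := h₁ u s hu hus hps le_rfl
    have h4 := h₂ s v le_rfl hv
    rw [abs_of_nonpos (by linarith : u - s ≤ 0)] at h3
    rw [abs_of_nonpos (by linarith : s - v ≤ 0)] at h4
    rw [abs_of_nonpos (by linarith : u - v ≤ 0)]
    linarith [abs_sub_le (f u) (f s) (f v)]
  intro u v hu hv
  rcases le_total u s with hus | hus <;> rcases le_total v s with hvs | hvs
  · exact h₁ u v hu hus hv hvs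
  · exact key u v hu hus hvs
  · rw [abs_sub_comm, abs_sub_comm u]
    exact key v u hv hvs hus
  · exact h₂ u v hus hvs

/-- For small step size the sup of a solution of the difference equation over a delay window is
halved after a fixed number of steps. -/
theorem exists_window_halving {q M : ℝ} (hq : 0 < q) {a r : ℝ → ℝ}
    (ha_cont : ∀ t, 0 ≤ t → ContinuousWithinAt a (Set.Ici t) t)
    (hr : ∀ t, 0 ≤ t → r t ∈ Set.Icc 0 q) (hM : ∀ t, 0 ≤ t → |a t| ≤ M)
    (hA1 : DelayUAS q a r) (hA3 : UniformContinuousOn r (Set.Ici 0)) :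
    ∃ h₀ > 0, ∀ h, 0 < h → h < h₀ → ∃ P : ℕ, 0 < P ∧ ∀ m : ℤ, 0 ≤ m → ∀ z,
      IsDifferenceSolution a r h m z → ∀ A > 0,
      (∀ j, m - ⌊q / h⌋ ≤ j → j ≤ m → |z j| ≤ A) →
      ∀ j, m + P - ⌊q / h⌋ ≤ j → j ≤ m + P → |z j| ≤ A / 2 := by
  have hM0 : 0 ≤ M := (abs_nonneg _).trans (hM 0 le_rfl)
  obtain ⟨K, hK, hKbound⟩ := hA1.exists_bound
  -- `g` bounds the growth of `z` over one delay window. Decay by `1 / (4 * g)` then brings `x` down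
  -- to `A / 4`.
  set g := Real.exp (M * q) with hg
  have hg0 : 0 < g := Real.exp_pos _
  obtain ⟨T, hT, hdecay⟩ := hA1.exists_decay_time (κ := 1 / (4 * g)) (by positivity)
  set G := M * (K * g) * Real.exp (M * (T + 2 * q)) with hG
  have hG0 : 0 ≤ G := by positivity
  -- `σ` will bound the error in the delayed argument, and `A * G * σ` the Grönwall error; the `+ 1`
  -- covers `G = 0`.
  set σ := 1 / (4 * (G + 1)) with hσ
  have hσ0 : 0 < σ := by positivity
  have hrc := hA3.continuousOn
  rw [Metric.uniformContinuousOn_iff] at hA3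
  obtain ⟨δ, hδ, hrδ⟩ := hA3 (σ / 2) (by positivity)
  refine ⟨min (σ / 4) (min δ q), by positivity, fun h hh hhlt => ?_⟩
  simp only [lt_min_iff] at hhlt
  obtain ⟨hhσ, hhδ, hhq⟩ := hhlt
  have hL1 : 1 ≤ ⌊q / h⌋ := Int.le_floor.2 (by rw [Int.cast_one, one_le_div hh]; exact hhq.le)
  obtain ⟨L, hL⟩ := Int.eq_ofNat_of_zero_le (zero_le_one.trans hL1)
  have hLr : (⌊q / h⌋ : ℝ) = L := by rw [hL]; simp
  have hLq := floor_div_mul_le (t := q) hh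
  have hLq' := lt_floor_div_add_one_mul (t := q) hh
  rw [hLr] at hLq hLq'
  set R := ⌈T / h⌉₊ with hR
  have hRT : T ≤ R * h := (div_le_iff₀ hh).1 (Nat.le_ceil _)
  have hRT' : R * h < T + h := by
    have h1 := Nat.ceil_lt_add_one (by positivity : 0 ≤ T / h)
    have h2 := mul_lt_mul_of_pos_right h1 hh
    rwa [add_mul, one_mul, div_mul_cancel₀ _ hh.ne'] at h2
  -- `L` steps make the data Lipschitz, `R` steps cover the decay time `T`, and `L` more put a whole
  -- delay window beyond it.
  refine ⟨L + R + L, by omega, fun m hm z hz A hA hzA j hj1 hj2 => ?_⟩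
  have hm' : (0 : ℝ) ≤ m := by exact_mod_cast hm
  set C := g * A with hC
  have hC0 : 0 < C := by positivity
  have hzC : ∀ i, m - ⌊q / h⌋ ≤ i → i ≤ m + L → |z i| ≤ C := by
    intro i hi1 hi2
    refine (hz.abs_le_growth hh hm hr hM hA.le hzA L i hi1 hi2).trans ?_
    rw [hC, mul_comm]
    refine mul_le_mul_of_nonneg_right ((one_add_pow_le_exp (by positivity) L).trans
      (Real.exp_le_exp.2 ?_)) hA.le
    nlinarith
  obtain ⟨ψ, hψL, hψc, hψC, hψz⟩ := exists_lipschitz_extension_of_grid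
    (l₁ := m) (l₂ := m + L) (z := z) (Λ := M * C) hh hC0.le (by positivity)
    (fun i hi1 hi2 => hzC i (by omega) hi2)
    (fun i j hi1 hi2 hj1 hj2 => hz.abs_sub_le hh hm hr hM hzC hi1 hi2 hj1 hj2)
  set s := ((m + L : ℤ) : ℝ) * h with hs
  have hs0 : 0 ≤ s := by
    rw [hs]
    push_cast
    positivity
  obtain ⟨x, hx, hxψ⟩ := exists_isDelaySolution (q := q) hs0 ha_cont hM (fun t ht => (hr t ht).1)
    hrc hψc hψC
  have hxini : ∀ t ∈ Set.Icc (s - q) s, |x t| ≤ C := fun t ht => by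
    rw [hxψ t ht.2]
    exact hψC t
  have hxB : ∀ t, s - q ≤ t → |x t| ≤ K * C := by
    intro t ht
    rcases le_total t s with hts | hts
    · exact (hxini t ⟨ht, hts⟩).trans (le_mul_of_one_le_left hC0.le hK)
    · exact hKbound s hs0 x hx C hC0 hxini t hts
  -- One Lipschitz constant across `s`, so the consistency error does not depend on `m`. This is why
  -- the initial function must be Lipschitz.
  have hxL := abs_sub_le_of_lipschitz_both_sides (f := x) (Λ := M * (K * C)) (p := s - q) (s := s)
    (by linarith)
    (fun u v _ hus _ hvs => by
      rw [hxψ u hus, hxψ v hvs]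
      refine (hψL u v).trans (mul_le_mul_of_nonneg_right
        (mul_le_mul_of_nonneg_left (le_mul_of_one_le_left hC0.le hK) hM0) (abs_nonneg _)))
    (fun u v hus hvs => hx.abs_sub_le hs0 hq.le hr hrc ha_cont hM hxB hus hvs)
  have hKC : 0 ≤ M * (K * C) := by positivity
  have hcmp := abs_delaySolution_sub_differenceSolution_le (N := R + L)
    (ω := M * (K * C) * σ) hq.le hh (by omega : 0 ≤ m + L) hr hrc ha_cont hM hx
    (hz.mono (by omega)) ?_ ?_ (R + L) le_rfl j (by omega) (by push_cast; omega)
  · have hjx : |x (j * h)| ≤ A / 4 := by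
      have h1 := hdecay s hs0 x hx C hC0 hxini (j * h) ?_
      · refine h1.trans (le_of_eq ?_)
        rw [hC]
        field_simp
      · have h2 : ((m + L + R : ℤ) : ℝ) ≤ j := by
          have : m + L + R ≤ j := by push_cast at hj1; omega
          exact_mod_cast this
        have h3 := mul_le_mul_of_nonneg_right h2 hh.le
        rw [hs]
        push_cast at h3 ⊢
        linarith
    have h4 : (1 + M * h) ^ (R + L) ≤ Real.exp (M * (T + 2 * q)) := by
      refine (one_add_pow_le_exp (by positivity) _).trans (Real.exp_le_exp.2 ?_)
      push_cast
      -- Rounding `T / h` up costs less than `h < q`, and the last window at most `q`.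
      have : ((R : ℝ) + L) * h ≤ T + 2 * q := by linarith
      nlinarith
    have h5 : M * (K * C) * σ * ((1 + M * h) ^ (R + L) - 1) ≤ A / 4 := by
      calc M * (K * C) * σ * ((1 + M * h) ^ (R + L) - 1)
          ≤ M * (K * C) * σ * Real.exp (M * (T + 2 * q)) := by
            refine mul_le_mul_of_nonneg_left (by linarith) (by positivity)
        _ = A / 4 * (G / (G + 1)) := by
            rw [hσ, hC, hG]
            field_simp
        _ ≤ A / 4 := by
            refine mul_le_of_le_one_right (by positivity) ?_
            rw [div_le_one (by positivity)]
            linarith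
    have h6 := abs_sub_abs_le_abs_sub (z j) (x (j * h))
    rw [abs_sub_comm] at h6
    linarith
  · intro i hi1 hi2
    rw [hxψ, hψz i (by omega) hi2]
    have : (i : ℝ) ≤ (m + L : ℤ) := by exact_mod_cast hi2
    exact mul_le_mul_of_nonneg_right this hh.le
  · intro n hn0 _ u hu
    have hn1 : ((m + L : ℤ) : ℝ) ≤ n := by exact_mod_cast hn0
    have hsn : s ≤ n * h := mul_le_mul_of_nonneg_right hn1 hh.le
    have hsu : s ≤ u := hsn.trans hu.1
    have hrn := hr _ (hs0.trans hsn)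
    have h6 : |r u - r (n * h)| ≤ σ / 2 := by
      refine (hrδ u (hs0.trans hsu) _ (hs0.trans hsn) ?_).le
      rw [Real.dist_eq, abs_lt]
      constructor <;> nlinarith [hu.1, hu.2]
    have h7 := abs_delayed_argument_sub_le hh hu h6
    refine (hxL _ _ (by linarith [(hr u (hs0.trans hsu)).2]) ?_).trans
      (mul_le_mul_of_nonneg_left (h7.trans (by linarith)) hKC)
    have := floor_div_mul_le (t := r (n * h)) hh
    push_cast
    nlinarith [hrn.2]

/-! ### From halving to uniform asymptotic stability -/

/-- Window halving implies uniform asymptotic stability of the difference equation. -/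
theorem differenceUAS_of_window_halving {q h M : ℝ} {a r : ℝ → ℝ} (hh : 0 < h)
    (hr : ∀ t, 0 ≤ t → r t ∈ Set.Icc 0 q) (hM : ∀ t, 0 ≤ t → |a t| ≤ M) {P : ℕ} (hP : 0 < P)
    (hhalf : ∀ m : ℤ, 0 ≤ m → ∀ z, IsDifferenceSolution a r h m z → ∀ A > 0,
      (∀ j, m - ⌊q / h⌋ ≤ j → j ≤ m → |z j| ≤ A) →
      ∀ j, m + P - ⌊q / h⌋ ≤ j → j ≤ m + P → |z j| ≤ A / 2) :
    DifferenceUAS q a r h := by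
  have hM0 : 0 ≤ M := (abs_nonneg _).trans (hM 0 le_rfl)
  have hL0 := (floor_div_mem hh (Set.right_mem_Icc.2 ((hr 0 le_rfl).1.trans (hr 0 le_rfl).2))).1
  set G := (1 + M * h) ^ P with hG
  have hG0 : 0 < G := by positivity
  have hwin : ∀ m : ℤ, 0 ≤ m → ∀ z, IsDifferenceSolution a r h m z → ∀ A > 0,
      (∀ j, m - ⌊q / h⌋ ≤ j → j ≤ m → |z j| ≤ A) → ∀ k : ℕ,
      ∀ j, m + k * P - ⌊q / h⌋ ≤ j → j ≤ m + k * P → |z j| ≤ A * (1 / 2) ^ k := by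
    intro m hm z hz A hA hzA k
    induction k with
    | zero => simpa using hzA
    | succ k ih =>
      intro j hj1 hj2
      have h0 : (0 : ℤ) ≤ k * P := by positivity
      have h1 := hhalf (m + k * P) (by omega) z (hz.mono (by omega)) (A * (1 / 2) ^ k)
        (by positivity) ih j (by push_cast at hj1; linarith) (by push_cast at hj2; linarith)
      rw [pow_succ]
      linarith
  have hbd : ∀ m : ℤ, 0 ≤ m → ∀ z, IsDifferenceSolution a r h m z → ∀ A > 0,
      (∀ j, m - ⌊q / h⌋ ≤ j → j ≤ m → |z j| ≤ A) → ∀ k : ℕ,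
      ∀ n, m + k * P ≤ n → |z n| ≤ A * (1 / 2) ^ k * G := by
    intro m hm z hz A hA hzA k n hn
    have hP' : (0 : ℤ) < P := by exact_mod_cast hP
    -- `i` counts the full blocks of length `P` before `n`; the incomplete last block costs at most
    -- the growth factor `G`.
    obtain ⟨i, hi⟩ := Int.eq_ofNat_of_zero_le
      (Int.ediv_nonneg (by nlinarith [Int.natCast_nonneg k] : 0 ≤ n - m) hP'.le)
    have hdiv := Int.mul_ediv_add_emod (n - m) P
    have hmod := Int.emod_lt_of_pos (n - m) hP'
    have hmod0 := Int.emod_nonneg (n - m) hP'.ne'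
    have hki : k ≤ i := by
      have : (k : ℤ) ≤ (n - m) / P := (Int.le_ediv_iff_mul_le hP').2 (by linarith)
      omega
    rw [hi, mul_comm] at hdiv
    have h0 : (0 : ℤ) ≤ (i : ℤ) * P := by positivity
    have h1 := (hz.mono (by omega : m ≤ m + i * P)).abs_le_growth hh (by omega) hr hM
      (by positivity) (hwin m hm z hz A hA hzA i) P n (by linarith) (by linarith)
    refine h1.trans (mul_le_mul_of_nonneg_right (mul_le_mul_of_nonneg_left ?_ hA.le) hG0.le)
    exact pow_le_pow_of_le_one (by norm_num) (by norm_num) hki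
  constructor
  · intro ε hε
    refine ⟨ε / (2 * G), by positivity, fun m hm z hz hzδ n hn => ?_⟩
    -- Stability is the case `k = 0` of `hbd`; attractivity takes `k` with `(1 / 2) ^ k * G < ε`.
    have h1 := hbd m hm z hz (ε / (2 * G)) (by positivity) (fun j hj1 hj2 => (hzδ j hj1 hj2).le)
      0 n (by simpa using hn)
    have h2 : ε / (2 * G) * (1 / 2) ^ 0 * G = ε / 2 := by field_simp
    linarith
  · refine ⟨1, one_pos, fun ε hε => ?_⟩
    obtain ⟨k, hk⟩ := exists_pow_lt_of_lt_one (by positivity : 0 < ε / G)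
      (by norm_num : (1 / 2 : ℝ) < 1)
    refine ⟨k * P, fun m hm z hz hz1 n hn => ?_⟩
    have h1 := hbd m hm z hz 1 one_pos (fun j hj1 hj2 => (hz1 j hj1 hj2).le) k n
      (by push_cast at hn; exact hn)
    rw [lt_div_iff₀ hG0] at hk
    linarith

theorem corollary4p2 (q : ℝ) (hq : 0 < q) (a r : ℝ → ℝ)
    (ha : ∀ t, 0 ≤ t → 0 ≤ a t)
    (ha_cont : ∀ t, 0 ≤ t → ContinuousWithinAt a (Set.Ici t) t)
    (hr : ∀ t, 0 ≤ t → r t ∈ Set.Icc 0 q)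
    (hA1 : DelayUAS q a r)
    (hA2 : BddAbove (a '' Set.Ici 0))
    (hA3 : UniformContinuousOn r (Set.Ici 0)) :
    (∀ φ : ℝ → ℝ, ContinuousOn φ (Set.Icc (-q) 0) →
      ∀ x : ℝ → ℝ, IsDelaySolution q a r 0 x → (∀ t ∈ Set.Icc (-q) 0, x t = φ t) →
      ∀ z : ℝ → ℝ → ℝ, (∀ h ∈ Set.Ioc 0 q, IsPCASolution q a r φ h (z h)) →
      ∀ t, 0 ≤ t →
        Filter.Tendsto (fun h => |x t - z h (gridFloor h t)|)
          (nhdsWithin 0 (Set.Ioi 0)) (nhds 0)) ∧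
    (∃ h₀ > 0, ∀ h, 0 < h → h < h₀ → DifferenceUAS q a r h) := by
  obtain ⟨M, hM⟩ := hA2
  have hM' : ∀ t, 0 ≤ t → |a t| ≤ M := fun t ht => by
    rw [abs_of_nonneg (ha t ht)]
    exact hM ⟨t, ht, rfl⟩
  refine ⟨fun φ _ x hx hxφ z hz t ht =>
    tendsto_delaySolution_sub_pcaSolution hq ha_cont hr hM' hA3 hx hxφ hz ht, ?_⟩
  obtain ⟨h₀, hh₀, H⟩ := exists_window_halving hq ha_cont hr hM' hA1 hA3
  refine ⟨h₀, hh₀, fun h hh hlt => ?_⟩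
  obtain ⟨P, hP, hhalf⟩ := H h hh hlt
  exact differenceUAS_of_window_halving hh hr hM' hP hhalf
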